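/- Let $\overline{\mathbb C}=\mathbb C\cup\{\infty\}$ be the Riemann sphere and let $K\subset\overline{\mathbb C}$ be a full continuum with at least two points, i.e. a compact connected set with at least two points whose complement $\overline{\mathbb C}\setminus K$ is (non-empty and) connected. Let $d_P$ be the Poincaré (hyperbolic) distance of the simply connected domain $\overline{\mathbb C}\setminus K$, i.e. the image of the Poincaré distance of curvature $-1$ on the upper half-plane $\mathbb H$ under a conformal equivalence $\mathbb H\to\overline{\mathbb C}\setminus K$. Let $l:\overline{\mathbb C}\to\overline{\mathbb C}$ be a homeomorphism such that - $l(z)=z$ for all $z\in K$ (so $l(K)=K$); - $d_P(l(z),z)\to 0$ as $z\to K$, $z\in\overline{\mathbb C}\setminus K$; that is, for every $\varepsilon>0$ there is a neighbourhood $U$ of $K$ in $\overline{\mathbb C}$ such that $d_P(l(z),z)<\varepsilon$ for all $z\in U\setminus K$. Then $l$ is (real) differentiable at every point $p\in K$ and its differential there is the identity, $D_pl=\mathrm{id}$. (Near a finite point differentiability is read in the coordinate $z$, and near $\infty$, if $\infty\in K$, in the coordinate $1/z$.) -/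

import Mathlib

open Filter Topology OnePoint
open scoped UpperHalfPlane

noncomputable section

namespace RiemannSphere

/-- The affine coordinate `z` on the Riemann sphere `OnePoint ℂ`, a chart on the complement of `∞`
(with the irrelevant value `0` at `∞`). -/
def affineCoord : OnePoint ℂ → ℂ
  | ∞ => 0
  | (z : ℂ) => z

/-- The coordinate `1 / z` at infinity, a chart on the complement of `0`, centred at `∞`
(with the irrelevant value `0` at `0`). -/
def inftyCoord : OnePoint ℂ → ℂ
  | ∞ => 0
  | (z : ℂ) => z⁻¹

/-- The inverse of the chart `1 / z`: it sends `0` to `∞` and `w ≠ 0` to `1 / w`. -/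
def inftyParam (w : ℂ) : OnePoint ℂ :=
  open Classical in if w = 0 then ∞ else ((w⁻¹ : ℂ) : OnePoint ℂ)

/-- The chart of the Riemann sphere used near the point `p`: `1 / z` if `p = ∞`, and `z` if `p`
is finite. -/
def chart : OnePoint ℂ → OnePoint ℂ → ℂ
  | ∞ => inftyCoord
  | (_ : ℂ) => affineCoord

/-- The inverse of `chart p`. -/
def chartSymm : OnePoint ℂ → ℂ → OnePoint ℂ
  | ∞ => inftyParam
  | (_ : ℂ) => fun z => (z : OnePoint ℂ)

/-- The self-map `l` of the Riemann sphere is (real) differentiable at `p`, with differential `A`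
when read in the charts at `p` and at `l p`. -/
def HasDifferentialAt (l : OnePoint ℂ → OnePoint ℂ) (A : ℂ →L[ℝ] ℂ) (p : OnePoint ℂ) : Prop :=
  ContinuousAt l p ∧
    HasFDerivAt (fun w : ℂ => chart (l p) (l (chartSymm p w))) A (chart p p)

/-- `f` is a conformal equivalence (a biholomorphism) of the upper half-plane onto the subset `Ω`
of the Riemann sphere: a bijection onto `Ω` that is holomorphic as a map to the Riemann sphere. -/
structure IsConformalEquiv (f : ℍ → OnePoint ℂ) (Ω : Set (OnePoint ℂ)) : Prop where
  injective : Function.Injective f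
  range_eq : Set.range f = Ω
  continuous : Continuous f
  differentiableAt : ∀ τ : ℍ,
    DifferentiableAt ℂ (fun z : ℂ => chart (f τ) (f (UpperHalfPlane.ofComplex z))) (τ : ℂ)

/-- The Poincaré (hyperbolic) distance of a simply connected hyperbolic domain `Ω` of the Riemann
sphere: the distance transported from the Poincaré distance of the upper half-plane (curvature
`-1`, Mathlib's distance on `ℍ`) by a conformal equivalence `f : ℍ → Ω`. All choices of `f` give
the same number, so the infimum over `f` is the common value. -/
def poincareEDist (Ω : Set (OnePoint ℂ)) (z w : OnePoint ℂ) : ENNReal :=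
  ⨅ (f : ℍ → OnePoint ℂ) (_ : IsConformalEquiv f Ω) (a : ℍ) (b : ℍ)
    (_ : f a = z) (_ : f b = w), edist a b

/-- A full continuum of the Riemann sphere with at least two points: a compact connected set with
connected complement. -/
structure IsFullContinuum (K : Set (OnePoint ℂ)) : Prop where
  isCompact : IsCompact K
  isConnected : IsConnected K
  isConnected_compl : IsConnected Kᶜ
  nontrivial : K.Nontrivial

end RiemannSphere

end

/-!
Let `p` be a point of the full continuum `K` and let `q ≠ p` be a finite point of `K`. A fractional
linear map `m` that sends `p` to `0` and `q` to `∞` turns every conformal equivalence `f : ℍ → Kᶜ`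
into an injective holomorphic function `g = m ∘ f` without zeros on the upper half-plane. Such a
function satisfies `|g' / g| ≤ C / im` with an absolute constant `C`: on a disc, `g` has a
holomorphic logarithm `h`, and since `g = exp h` is injective, `h` never takes two values that
differ by `2πi`, so the image of `h` contains no disc of radius larger than `π`; Bloch's theorem
(`exists_ball_subset_image_ball`, in a weak form) then bounds `h' = g' / g`
(`norm_logDeriv_le_of_injOn_ball`). Consequently `g a / g b` is close to `1` as soon as the
hyperbolic distance of `a` and `b` is small, uniformly in `g`
(`exists_norm_div_sub_one_lt_of_dist_lt`).

The hypothesis on the homeomorphism `l` therefore says that `m (l z) / m z` tends to `1` as `z`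
tends to `p` outside `K` (`eventually_norm_fracLinear_div_sub_one_lt`). Since `m` vanishes to first
order at `p`, this means that in the chart at `p` the displacement of `l` is `o(w - w₀)`, which,
together with `l = id` on `K`, is differentiability at `p` with differential the identity. The
Riemann mapping theorem is not needed: an infimum over conformal equivalences that is smaller than
`∞` is an infimum over a nonempty family.
-/

/-! ### Bloch's theorem -/

/-- A weak form of **Bloch's theorem**. The constant `1 / 96` is not optimal; it comes from working
on the closed disc of radius `R / 2` and from crude bounds for the variation of the derivative. -/
theorem exists_ball_subset_image_ball {F : ℂ → ℂ} {c : ℂ} {R : ℝ} (hR : 0 < R)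
    (hF : DifferentiableOn ℂ F (Metric.ball c R)) :
    ∃ w, Metric.ball w (R * ‖deriv F c‖ / 96) ⊆ F '' Metric.ball c R := by
  have hF' : DifferentiableOn ℂ (deriv F) (Metric.ball c R) := hF.deriv Metric.isOpen_ball
  rcases (norm_nonneg (deriv F c)).eq_or_lt with h0 | hM
  · exact ⟨0, by simp [← h0]⟩
  have hsub : Metric.closedBall c (R / 2) ⊆ Metric.ball c R :=
    Metric.closedBall_subset_ball (by linarith)
  -- Maximizing `(R / 2 - |z - c|) * |F' z|` yields a centre around which `F'` is bounded by twice
  -- its value at the centre.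
  obtain ⟨z₀, hz₀, hmax⟩ := (isCompact_closedBall c (R / 2)).exists_isMaxOn
    ⟨c, Metric.mem_closedBall_self (by positivity)⟩
    (f := fun z => (R / 2 - dist z c) * ‖deriv F z‖)
    (by
      have := (hF'.continuousOn.mono hsub).norm
      fun_prop)
  have hφc : R / 2 * ‖deriv F c‖ ≤ (R / 2 - dist z₀ c) * ‖deriv F z₀‖ := by
    simpa using hmax (Metric.mem_closedBall_self (by positivity : (0 : ℝ) ≤ R / 2))
  have hφpos : 0 < (R / 2 - dist z₀ c) * ‖deriv F z₀‖ := lt_of_lt_of_le (by positivity) hφc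
  rw [Metric.mem_closedBall] at hz₀
  have hd : 0 < R / 2 - dist z₀ c := pos_of_mul_pos_left hφpos (norm_nonneg _)
  have hA : 0 < ‖deriv F z₀‖ := pos_of_mul_pos_right hφpos hd.le
  set A := ‖deriv F z₀‖
  obtain ⟨ρ, hρ⟩ : ∃ ρ, ρ = (R / 2 - dist z₀ c) / 2 := ⟨_, rfl⟩
  have hρ0 : 0 < ρ := by linarith
  have hball : Metric.ball z₀ ρ ⊆ Metric.ball c R := fun z hz => by
    have := dist_triangle z z₀ c
    rw [Metric.mem_ball] at *
    linarith [dist_nonneg (x := z₀) (y := c)]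
  have hbound : ∀ z ∈ Metric.ball z₀ ρ, ‖deriv F z‖ ≤ 2 * A := fun z hz => by
    have htri := dist_triangle z z₀ c
    rw [Metric.mem_ball] at hz
    have h1 : (R / 2 - dist z c) * ‖deriv F z‖ ≤ (R / 2 - dist z₀ c) * A :=
      hmax (Metric.mem_closedBall.2 (by linarith))
    have h2 : ρ * ‖deriv F z‖ ≤ (R / 2 - dist z c) * ‖deriv F z‖ := by gcongr; linarith
    have h3 : ρ * ‖deriv F z‖ ≤ ρ * (2 * A) := by
      calc _ ≤ _ := h2.trans h1
        _ = ρ * (2 * A) := by rw [hρ]; ring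
    exact le_of_mul_le_mul_left h3 hρ0
  have hschwarz : ∀ z ∈ Metric.ball z₀ ρ, dist (deriv F z) (deriv F z₀) ≤ 3 * A / ρ * dist z z₀ :=
    fun z hz => Complex.dist_le_div_mul_dist_of_mapsTo_ball (hF'.mono hball)
      (fun y hy => by
        rw [Metric.mem_closedBall, dist_eq_norm]
        linarith [norm_sub_le (deriv F y) (deriv F z₀), hbound y hy]) hz
  have hr : Metric.closedBall z₀ (ρ / 6) ⊆ Metric.ball z₀ ρ :=
    Metric.closedBall_subset_ball (by linarith)
  have hdiff : ∀ z ∈ Metric.closedBall z₀ (ρ / 6), DifferentiableAt ℂ F z := fun z hz =>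
    hF.differentiableAt (Metric.isOpen_ball.mem_nhds (hball (hr hz)))
  refine ⟨F z₀, ?_⟩
  have hcover := DiffContOnCl.ball_subset_image_closedBall (f := F) (z₀ := z₀) (r := ρ / 6)
    (ε := A * (ρ / 6) / 2)
    ((hF.mono (hr.trans hball)).diffContOnCl_ball subset_rfl) (by positivity)
    (fun z hz => by
      have hz' : ‖z - z₀‖ = ρ / 6 := by simpa [dist_eq_norm] using hz
      have hmv := Convex.norm_image_sub_le_of_norm_deriv_le
        (f := fun y => F y - deriv F z₀ * y) (C := A / 2) (x := z₀) (y := z)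
        (s := Metric.closedBall z₀ (ρ / 6))
        (fun y hy => (hdiff y hy).sub (by fun_prop))
        (fun y hy => by
          have hder : deriv (fun y => F y - deriv F z₀ * y) y = deriv F y - deriv F z₀ := by
            rw [deriv_fun_sub (hdiff y hy) (by fun_prop), deriv_const_mul_id']
          rw [hder, ← dist_eq_norm]
          refine (hschwarz y (hr hy)).trans ?_
          calc 3 * A / ρ * dist y z₀ ≤ 3 * A / ρ * (ρ / 6) := by
                gcongr; exact Metric.mem_closedBall.1 hy
            _ = A / 2 := by field_simp; norm_num)
        (convex_closedBall _ _) (Metric.mem_closedBall_self (by positivity))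
        (Metric.sphere_subset_closedBall hz)
      have hlin : ‖deriv F z₀ * (z - z₀)‖ = A * (ρ / 6) := by rw [norm_mul, hz']
      have heq : deriv F z₀ * (z - z₀) =
          (F z - F z₀) - ((F z - deriv F z₀ * z) - (F z₀ - deriv F z₀ * z₀)) := by ring
      have := norm_sub_le (F z - F z₀) ((F z - deriv F z₀ * z) - (F z₀ - deriv F z₀ * z₀))
      rw [← heq, hlin] at this
      rw [hz'] at hmv
      linarith)
    (((hdiff z₀ (Metric.mem_closedBall_self (by positivity))).hasDerivAt.eventually_ne
      (norm_pos_iff.1 hA)).frequently.filter_mono nhdsWithin_le_nhds)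
  refine (Metric.ball_subset_ball ?_).trans (hcover.trans (Set.image_mono (hr.trans hball)))
  have : ρ * A = (R / 2 - dist z₀ c) * A / 2 := by rw [hρ]; ring
  linarith

/-! ### Non-vanishing univalent functions -/

/-- A holomorphic function without zeros on a disc has a holomorphic logarithm there. -/
theorem exists_log_on_ball {g : ℂ → ℂ} {c : ℂ} {R : ℝ} (hR : 0 < R)
    (hg : DifferentiableOn ℂ g (Metric.ball c R)) (h0 : ∀ z ∈ Metric.ball c R, g z ≠ 0) :
    ∃ h : ℂ → ℂ, DifferentiableOn ℂ h (Metric.ball c R) ∧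
      (∀ z ∈ Metric.ball c R, Complex.exp (h z) = g z) ∧
      ∀ z ∈ Metric.ball c R, deriv h z = deriv g z / g z := by
  have hc : c ∈ Metric.ball c R := Metric.mem_ball_self hR
  obtain ⟨h, hhc, hh⟩ := ((hg.deriv Metric.isOpen_ball).div hg h0).isExactOn_ball.with_val_at c
    (Complex.log (g c))
  refine ⟨h, fun z hz => (hh z hz).differentiableAt.differentiableWithinAt, fun z hz => ?_,
    fun z hz => (hh z hz).deriv⟩
  have hconst := (convex_ball c R).is_const_of_fderivWithin_eq_zero (𝕜 := ℂ)
    (f := fun z => g z * Complex.exp (-h z)) (x := z) (y := c)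
    (fun y hy => ((hg y hy).mul
      ((hh y hy).differentiableAt.differentiableWithinAt.neg.cexp)))
    (fun y hy => by
      have h1 := (hg.differentiableAt (Metric.isOpen_ball.mem_nhds hy)).hasDerivAt.mul
        ((hh y hy).neg.cexp)
      have h2 : HasDerivAt (fun z => g z * Complex.exp (-h z)) 0 y := by
        refine h1.congr_deriv ?_
        have := div_mul_cancel₀ (deriv g y) (h0 y hy)
        rw [Pi.div_apply, Pi.neg_apply]
        linear_combination -Complex.exp (-h y) * this
      rw [fderivWithin_of_isOpen Metric.isOpen_ball hy]
      ext
      simpa using h2.deriv)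
    hz hc
  simp only [hhc, Complex.exp_neg, Complex.exp_log (h0 c hc), mul_inv_cancel₀ (h0 c hc)] at hconst
  rw [← div_eq_mul_inv, div_eq_one_iff_eq (Complex.exp_ne_zero _)] at hconst
  exact hconst.symm

/-- The logarithm of an injective function never takes two values that differ by `2πi`, so its
image contains no disc of radius larger than `π`, and Bloch's theorem bounds its derivative. -/
theorem norm_logDeriv_le_of_injOn_ball {g : ℂ → ℂ} {c : ℂ} {R : ℝ} (hR : 0 < R)
    (hg : DifferentiableOn ℂ g (Metric.ball c R)) (h0 : ∀ z ∈ Metric.ball c R, g z ≠ 0)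
    (hinj : Set.InjOn g (Metric.ball c R)) :
    ‖deriv g c / g c‖ ≤ 96 * Real.pi / R := by
  obtain ⟨h, hd, hexp, hder⟩ := exists_log_on_ball hR hg h0
  rw [← hder c (Metric.mem_ball_self hR)]
  by_contra! hlt
  rw [div_lt_iff₀ hR] at hlt
  obtain ⟨w, hw⟩ := exists_ball_subset_image_ball hR hd
  have hpi : ‖(Real.pi : ℂ) * Complex.I‖ < R * ‖deriv h c‖ / 96 := by
    rw [norm_mul, Complex.norm_I, mul_one, Complex.norm_real, Real.norm_eq_abs,
      abs_of_pos Real.pi_pos]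
    linarith
  obtain ⟨x, hx, hxw⟩ := hw (show w + Real.pi * Complex.I ∈ _ by simpa [dist_eq_norm] using hpi)
  obtain ⟨y, hy, hyw⟩ := hw (show w - Real.pi * Complex.I ∈ _ by simpa [dist_eq_norm] using hpi)
  have hxy : x = y := hinj hx hy (by
    rw [← hexp x hx, ← hexp y hy, hxw, hyw, Complex.exp_eq_exp_iff_exists_int]
    exact ⟨1, by push_cast; ring⟩)
  rw [hxy, hyw] at hxw
  have : (Real.pi : ℂ) * Complex.I = 0 := by linear_combination -hxw / 2
  simp [Real.pi_ne_zero] at this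

/-- The logarithmic derivative bound, integrated along a segment. -/
theorem exists_exp_eq_div_of_injOn_ball {g : ℂ → ℂ} {a c : ℂ} {R : ℝ} (hR : 0 < R)
    (hg : DifferentiableOn ℂ g (Metric.ball c R)) (h0 : ∀ z ∈ Metric.ball c R, g z ≠ 0)
    (hinj : Set.InjOn g (Metric.ball c R)) (ha : dist a c < R / 2) :
    ∃ u : ℂ, Complex.exp u = g a / g c ∧ ‖u‖ ≤ 192 * Real.pi * (dist a c / R) := by
  obtain ⟨h, hd, hexp, hder⟩ := exists_log_on_ball hR hg h0
  have hsub : Metric.ball c (R / 2) ⊆ Metric.ball c R := Metric.ball_subset_ball (by linarith)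
  have hcR : c ∈ Metric.ball c (R / 2) := Metric.mem_ball_self (by positivity)
  refine ⟨h a - h c, by rw [Complex.exp_sub, hexp a (hsub ha), hexp c (hsub hcR)], ?_⟩
  have hmv := Convex.norm_image_sub_le_of_norm_deriv_le (f := h) (C := 96 * Real.pi / (R / 2))
    (x := c) (y := a) (s := Metric.ball c (R / 2))
    (fun y hy => hd.differentiableAt (Metric.isOpen_ball.mem_nhds (hsub hy)))
    (fun y hy => by
      rw [hder y (hsub hy)]
      have hy' : Metric.ball y (R / 2) ⊆ Metric.ball c R :=
        Metric.ball_subset_ball' (by rw [Metric.mem_ball] at hy; linarith)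
      exact norm_logDeriv_le_of_injOn_ball (by positivity) (hg.mono hy')
        (fun z hz => h0 z (hy' hz)) (hinj.mono hy'))
    (convex_ball _ _) hcR ha
  rw [← dist_eq_norm a c] at hmv
  refine hmv.trans_eq ?_
  field_simp
  ring

/-- A non-vanishing univalent function on the upper half-plane has nearly equal values at
hyperbolically close points, uniformly over all such functions. -/
theorem exists_norm_div_sub_one_lt_of_dist_lt {η : ℝ} (hη : 0 < η) :
    ∃ ε > 0, ∀ g : ℂ → ℂ, DifferentiableOn ℂ g {z | 0 < z.im} → (∀ z, 0 < z.im → g z ≠ 0) →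
      Set.InjOn g {z | 0 < z.im} → ∀ a b : ℍ, dist a b < ε → ‖g a / g b - 1‖ < η := by
  obtain ⟨δ, hδ, hexp⟩ := Metric.continuousAt_iff.1
    (Complex.continuous_exp.continuousAt (x := 0)) η hη
  have hlim : Tendsto (fun t : ℝ => Real.exp t - 1) (𝓝 0) (𝓝 0) := by
    have : Continuous fun t : ℝ => Real.exp t - 1 := by fun_prop
    simpa using this.tendsto 0
  obtain ⟨ε, hε, hsmall⟩ := Metric.eventually_nhds_iff.1
    (hlim.eventually (gt_mem_nhds (show 0 < min (1 / 2) (δ / (192 * Real.pi)) by positivity)))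
  refine ⟨ε, hε, fun g hg h0 hinj a b hab => ?_⟩
  have hlt := hsmall (y := dist a b) (by simpa using hab)
  rw [lt_min_iff, lt_div_iff₀ (by positivity : 0 < 192 * Real.pi)] at hlt
  have hb : 0 < (b : ℂ).im := b.im_pos
  have hball : Metric.ball (b : ℂ) (b : ℂ).im ⊆ {z : ℂ | 0 < z.im} := fun z hz => by
    have h1 := (Complex.abs_im_le_norm (z - b)).trans_lt (by simpa [dist_eq_norm] using hz)
    rw [Complex.sub_im] at h1
    have h2 : -(b : ℂ).im < z.im - (b : ℂ).im := (abs_lt.1 h1).1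
    change 0 < z.im
    linarith
  have hdist : dist (a : ℂ) b ≤ (b : ℂ).im * (Real.exp (dist a b) - 1) :=
    UpperHalfPlane.dist_coe_le a b
  obtain ⟨u, hu, hun⟩ := exists_exp_eq_div_of_injOn_ball (a := a) hb (hg.mono hball)
    (fun z hz => h0 z (hball hz)) (hinj.mono hball)
    (hdist.trans_lt (by rw [div_eq_mul_one_div]; gcongr; exact hlt.1))
  have huδ : ‖u‖ < δ := by
    refine hun.trans_lt (lt_of_le_of_lt ?_ hlt.2)
    rw [mul_comm]
    gcongr
    rwa [div_le_iff₀' hb]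
  rw [← hu]
  simpa [dist_eq_norm] using hexp (x := u) (by simpa [dist_eq_norm] using huδ)

/-! ### Moving a boundary point to zero and another to infinity -/

namespace RiemannSphere

/-- The map `z ↦ (α z + β) / (z - q)` on the Riemann sphere, with its value `α` at `∞`
(and the irrelevant value `0` at the pole `q`). -/
noncomputable def fracLinear (α β q : ℂ) : OnePoint ℂ → ℂ
  | ∞ => α
  | (z : ℂ) => (α * z + β) / (z - q)

@[simp]
theorem fracLinear_infty (α β q : ℂ) : fracLinear α β q ∞ = α := rfl

@[simp]
theorem fracLinear_coe (α β q z : ℂ) : fracLinear α β q z = (α * z + β) / (z - q) := rfl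

theorem fracLinear_injOn {α β q : ℂ} (h : α * q + β ≠ 0) :
    Set.InjOn (fracLinear α β q) {(q : OnePoint ℂ)}ᶜ := by
  intro x hx y hy hxy
  induction x using OnePoint.rec with
  | infty =>
    induction y using OnePoint.rec with
    | infty => rfl
    | coe y =>
      have hy' : y - q ≠ 0 := sub_ne_zero.2 fun h => hy (by simp [h])
      rw [fracLinear_infty, fracLinear_coe, eq_div_iff hy'] at hxy
      exact absurd (by linear_combination -hxy) h
  | coe x =>
    have hx' : x - q ≠ 0 := sub_ne_zero.2 fun h => hx (by simp [h])
    induction y using OnePoint.rec with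
    | infty =>
      rw [fracLinear_infty, fracLinear_coe, div_eq_iff hx'] at hxy
      exact absurd (by linear_combination hxy) h
    | coe y =>
      have hy' : y - q ≠ 0 := sub_ne_zero.2 fun h => hy (by simp [h])
      rw [fracLinear_coe, fracLinear_coe, div_eq_div_iff hx' hy'] at hxy
      rw [sub_eq_zero.1 ((mul_eq_zero.1 (show (α * q + β) * (x - y) = 0 by
        linear_combination -hxy)).resolve_left h)]

theorem IsConformalEquiv.differentiableOn_fracLinear {f : ℍ → OnePoint ℂ} {Ω : Set (OnePoint ℂ)}
    (hf : IsConformalEquiv f Ω) {q : ℂ} (hq : (q : OnePoint ℂ) ∉ Ω) (α β : ℂ) :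
    DifferentiableOn ℂ (fun z => fracLinear α β q (f (UpperHalfPlane.ofComplex z)))
      {z | 0 < z.im} := by
  intro z hz
  refine DifferentiableAt.differentiableWithinAt ?_
  have hcont : ContinuousAt (fun z => f (UpperHalfPlane.ofComplex z)) z :=
    hf.continuous.continuousAt.comp (UpperHalfPlane.mdifferentiableAt_ofComplex hz).continuousAt
  have hne : ∀ z, f (UpperHalfPlane.ofComplex z) ≠ q := fun z h =>
    hq (by rw [← h, ← hf.range_eq]; exact Set.mem_range_self _)
  have hd := hf.differentiableAt (UpperHalfPlane.ofComplex z)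
  rw [UpperHalfPlane.ofComplex_apply_of_im_pos hz, UpperHalfPlane.coe_mk,
    ← UpperHalfPlane.ofComplex_apply_of_im_pos hz] at hd
  generalize hw : f (UpperHalfPlane.ofComplex z) = w at hd
  induction w using OnePoint.rec with
  | infty =>
    -- Near a pole `f` is read in the coordinate `w = 1 / z`, where the map is
    -- `(α + β w) / (1 - q w)`.
    change DifferentiableAt ℂ (fun y => inftyCoord (f (UpperHalfPlane.ofComplex y))) z at hd
    have h1 : 1 - q * inftyCoord (f (UpperHalfPlane.ofComplex z)) ≠ 0 := by
      rw [hw]; simp [inftyCoord]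
    refine DifferentiableAt.congr_of_eventuallyEq
      (((hd.const_mul β).const_add α).div ((hd.const_mul q).const_sub 1) h1) ?_
    filter_upwards [hcont.eventually_ne (by rw [hw]; exact OnePoint.infty_ne_coe 0)] with y hy
    have hy' := hne y
    change fracLinear α β q _ = (α + β * inftyCoord _) / (1 - q * inftyCoord _)
    generalize f (UpperHalfPlane.ofComplex y) = v at hy hy'
    induction v using OnePoint.rec with
    | infty => simp [fracLinear, inftyCoord]
    | coe v =>
      have hv : v ≠ 0 := fun h => hy (by simp [h])
      have hvq : v - q ≠ 0 := sub_ne_zero.2 fun h => hy' (by simp [h])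
      have : 1 - q * v⁻¹ ≠ 0 := by field_simp; exact div_ne_zero hvq hv
      rw [fracLinear_coe, show inftyCoord (v : OnePoint ℂ) = v⁻¹ from rfl, div_eq_div_iff hvq this]
      field_simp
  | coe w =>
    change DifferentiableAt ℂ (fun y => affineCoord (f (UpperHalfPlane.ofComplex y))) z at hd
    have h1 : affineCoord (f (UpperHalfPlane.ofComplex z)) - q ≠ 0 := by
      have := hne z
      rw [hw] at this ⊢
      exact sub_ne_zero.2 fun h => this (by rw [← h]; rfl)
    refine DifferentiableAt.congr_of_eventuallyEq
      (((hd.const_mul α).add_const β).div (hd.sub_const q) h1) ?_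
    filter_upwards [hcont.eventually_ne (by rw [hw]; exact OnePoint.coe_ne_infty w)] with y hy
    change fracLinear α β q _ = (α * affineCoord _ + β) / (affineCoord _ - q)
    generalize f (UpperHalfPlane.ofComplex y) = v at hy
    induction v using OnePoint.rec with
    | infty => exact absurd rfl hy
    | coe v => rfl

/-- If `K` contains the zero and the pole `q` of the map `z ↦ (α z + β) / (z - q)`, a map `l` that
moves points near `K` by a small Poincaré distance changes the value of this map only by a factor
close to `1`. Near `K` the finiteness of the Poincaré distance supplies the conformal equivalence
to which the estimate on the half-plane is applied. -/
theorem eventually_norm_fracLinear_div_sub_one_lt {K : Set (OnePoint ℂ)}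
    {l : OnePoint ℂ → OnePoint ℂ}
    (hd : Tendsto (fun z => poincareEDist Kᶜ (l z) z) (𝓝ˢ K ⊓ 𝓟 Kᶜ) (𝓝 0))
    {p : OnePoint ℂ} (hp : p ∈ K) {α β q : ℂ} (hq : (q : OnePoint ℂ) ∈ K) (hαβ : α * q + β ≠ 0)
    (hzero : ∀ z ∉ K, fracLinear α β q z ≠ 0) {η : ℝ} (hη : 0 < η) :
    ∀ᶠ z in 𝓝 p, z ∉ K → ‖fracLinear α β q (l z) / fracLinear α β q z - 1‖ < η := by
  obtain ⟨ε, hε, h⟩ := exists_norm_div_sub_one_lt_of_dist_lt hη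
  have hev := hd.eventually (gt_mem_nhds (ENNReal.ofReal_pos.2 hε))
  rw [eventually_inf_principal] at hev
  filter_upwards [(nhds_le_nhdsSet hp) hev] with z hz hzK
  have hlt := hz hzK
  simp only [poincareEDist, iInf_lt_iff] at hlt
  obtain ⟨f, hf, a, b, ha, hb, hab⟩ := hlt
  have hfK : ∀ τ, f τ ∉ K := fun τ => by
    have : f τ ∈ Set.range f := Set.mem_range_self τ
    rwa [hf.range_eq] at this
  have := h (fun z => fracLinear α β q (f (UpperHalfPlane.ofComplex z)))
    (hf.differentiableOn_fracLinear (by simpa using hq) α β) (fun z _ => hzero _ (hfK _))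
    (fun x hx y hy hxy => by
      have h1 := hf.injective (fracLinear_injOn hαβ (fun h => hfK _ (by rw [h]; exact hq))
        (fun h => hfK _ (by rw [h]; exact hq)) hxy)
      rw [UpperHalfPlane.ofComplex_apply_of_im_pos hx,
        UpperHalfPlane.ofComplex_apply_of_im_pos hy] at h1
      exact congrArg UpperHalfPlane.coe h1) a b
    (by rwa [edist_dist, ENNReal.ofReal_lt_ofReal_iff hε] at hab)
  simpa only [UpperHalfPlane.ofComplex_apply, ha, hb] using this

/-! ### The differential in a chart -/

theorem continuousAt_affineCoord (p : ℂ) : ContinuousAt affineCoord (p : OnePoint ℂ) :=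
  OnePoint.continuousAt_coe.2 continuousAt_id

theorem continuousAt_inftyCoord_infty : ContinuousAt inftyCoord ∞ := by
  rw [OnePoint.continuousAt_infty', coclosedCompact_eq_cocompact,
    ← Metric.cobounded_eq_cocompact]
  exact tendsto_inv₀_cobounded (α := ℂ)

theorem continuousAt_inftyParam_zero : ContinuousAt inftyParam 0 := by
  rw [← continuousWithinAt_compl_self]
  have : Tendsto (fun w : ℂ => ((w⁻¹ : ℂ) : OnePoint ℂ)) (𝓝[≠] 0) (𝓝 ∞) := by
    refine OnePoint.tendsto_coe_infty.comp ?_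
    rw [coclosedCompact_eq_cocompact, ← Metric.cobounded_eq_cocompact]
    exact tendsto_inv₀_nhdsNE_zero (α := ℂ)
  rw [ContinuousWithinAt, show inftyParam 0 = ∞ from if_pos rfl]
  refine this.congr' ?_
  filter_upwards [self_mem_nhdsWithin] with w hw
  exact (if_neg hw).symm

/-- A map of `ℂ` whose displacement at `w` is `(w - w₀) * e * B`, with `e` arbitrarily small and `B`
bounded near `w₀`, has the identity as differential at `w₀`. -/
theorem hasFDerivAt_id_of_norm_sub_le {F : ℂ → ℂ} {w₀ : ℂ} (h0 : F w₀ = w₀) (B : ℂ → ℝ)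
    (hB : ContinuousAt B w₀)
    (h : ∀ η > 0, ∀ᶠ w in 𝓝 w₀, ‖F w - w‖ ≤ η * |B w| * ‖w - w₀‖) :
    HasFDerivAt F (ContinuousLinearMap.id ℝ ℂ) w₀ := by
  rw [hasFDerivAt_iff_isLittleO, Asymptotics.isLittleO_iff]
  intro c hc
  have hpos : 0 < |B w₀| + 1 := by positivity
  filter_upwards [h (c / (|B w₀| + 1)) (by positivity),
    hB.abs.eventually (gt_mem_nhds (lt_add_one |B w₀|))] with w hw hBw
  rw [h0, ContinuousLinearMap.id_apply, sub_sub_sub_cancel_right]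
  refine hw.trans ?_
  gcongr
  rw [div_mul_eq_mul_div, div_le_iff₀ hpos]
  gcongr

end RiemannSphere

open RiemannSphere

theorem mainTheorem12 (K : Set (OnePoint ℂ)) (hK : RiemannSphere.IsFullContinuum K)
    (l : OnePoint ℂ ≃ₜ OnePoint ℂ) (hl : ∀ z ∈ K, l z = z)
    (hd : Tendsto (fun z => RiemannSphere.poincareEDist Kᶜ (l z) z) (𝓝ˢ K ⊓ 𝓟 Kᶜ) (𝓝 0)) :
    ∀ p ∈ K, RiemannSphere.HasDifferentialAt l (ContinuousLinearMap.id ℝ ℂ) p := by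
  intro p hp
  refine ⟨l.continuous.continuousAt, ?_⟩
  rw [hl p hp]
  -- A nontrivial connected set is infinite, so `K` has a finite point other than `p`.
  obtain ⟨q, hqK, hqp⟩ : ∃ q : ℂ, (q : OnePoint ℂ) ∈ K ∧ (q : OnePoint ℂ) ≠ p := by
    have hinf := hK.isConnected.isPreconnected.infinite_of_nontrivial hK.nontrivial
    obtain ⟨x, hx, hx'⟩ := (hinf.sdiff (Set.toFinite {p, ∞})).nonempty
    simp only [Set.mem_insert_iff, Set.mem_singleton_iff, not_or] at hx'
    obtain ⟨q, rfl⟩ := OnePoint.ne_infty_iff_exists.1 hx'.2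
    exact ⟨q, hx, hx'.1⟩
  induction p using OnePoint.rec with
  | infty =>
    -- In the coordinate `w = 1 / z` the auxiliary map `1 / (z - q)` is `m w = w / (1 - q w)`, and
    -- `w' - w = (m w' / m w - 1) * (1 - q w') * w`.
    change HasFDerivAt (fun w => inftyCoord (l (inftyParam w))) _ 0
    have hparam : inftyParam 0 = ∞ := if_pos rfl
    have hlcont : ContinuousAt (fun w => l (inftyParam w)) 0 :=
      l.continuous.continuousAt.comp continuousAt_inftyParam_zero
    have hl0 : l (inftyParam 0) = ∞ := by rw [hparam, hl _ hp]
    have hFcont : ContinuousAt (fun w => inftyCoord (l (inftyParam w))) 0 :=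
      ContinuousAt.comp (g := inftyCoord) (by rw [hl0]; exact continuousAt_inftyCoord_infty) hlcont
    have hF0 : inftyCoord (l (inftyParam 0)) = 0 := by rw [hl0]; rfl
    refine hasFDerivAt_id_of_norm_sub_le hF0 (fun w => ‖1 - q * inftyCoord (l (inftyParam w))‖)
      (by fun_prop) fun η hη => ?_
    have hsmall := continuousAt_inftyParam_zero.tendsto.eventually <| hparam ▸
      eventually_norm_fracLinear_div_sub_one_lt (α := 0) (β := 1) hd hp hqK (by simp)
        (fun z hz => by
          induction z using OnePoint.rec with
          | infty => exact absurd hp hz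
          | coe z =>
            have : z - q ≠ 0 := sub_ne_zero.2 fun h => hz (h ▸ hqK)
            simp [fracLinear, this]) hη
    filter_upwards [hsmall, hlcont.eventually_ne (by rw [hl0]; exact OnePoint.infty_ne_coe 0)]
      with w hw hlw
    have hcoord : inftyCoord (inftyParam w) = w := by
      by_cases h : w = 0
      · simp [h, hparam, inftyCoord]
      · simp [inftyParam, h, inftyCoord]
    by_cases hwK : inftyParam w ∈ K
    · rw [hl _ hwK, hcoord, sub_self, norm_zero]
      positivity
    have hlwK : l (inftyParam w) ∉ K := fun h => hwK (l.injective (hl _ h) ▸ h)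
    replace hw := hw hwK
    have hw0 : w ≠ 0 := fun h => hwK (by rwa [h, hparam])
    have hwp : inftyParam w = ((w⁻¹ : ℂ) : OnePoint ℂ) := if_neg hw0
    rw [abs_norm, sub_zero]
    have hne : inftyParam w ≠ q := fun h => hwK (h ▸ hqK)
    rw [hwp] at hne
    generalize l (inftyParam w) = v at hw hlw hlwK
    rw [hwp] at hw
    induction v using OnePoint.rec with
    | infty => exact absurd hp hlwK
    | coe v =>
      have hv : v ≠ 0 := fun h => hlw (by simp [h])
      have hvq : v - q ≠ 0 := sub_ne_zero.2 fun h => hlwK (h ▸ hqK)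
      have hwq : w⁻¹ - q ≠ 0 := sub_ne_zero.2 fun h => hne (by simp [h])
      have key : inftyCoord (v : OnePoint ℂ) - w =
          (fracLinear 0 1 q v / fracLinear 0 1 q (w⁻¹ : ℂ) - 1) *
            (1 - q * inftyCoord (v : OnePoint ℂ)) * w := by
        have := mul_inv_cancel₀ hw0
        simp only [inftyCoord, fracLinear_coe]
        field_simp
        linear_combination -(1 - w * q) * this
      rw [key, norm_mul, norm_mul]
      gcongr
  | coe p =>
    -- For `m w = (w - p) / (w - q)` one has
    -- `w' - w = (m w' / m w - 1) * ((w' - q) / (p - q)) * (w - p)`.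
    change HasFDerivAt (fun w : ℂ => affineCoord (l w)) _ p
    have hpq : p - q ≠ 0 := sub_ne_zero.2 fun h => hqp (by rw [h])
    have hlcont : ContinuousAt (fun w : ℂ => l w) p :=
      (l.continuous.comp OnePoint.continuous_coe).continuousAt
    have hl0 : l p = p := hl _ hp
    have hFcont : ContinuousAt (fun w : ℂ => affineCoord (l w)) p :=
      ContinuousAt.comp (g := affineCoord) (by rw [hl0]; exact continuousAt_affineCoord p) hlcont
    have hF0 : affineCoord (l p) = p := by rw [hl0]; rfl
    refine hasFDerivAt_id_of_norm_sub_le hF0 (fun w => ‖(affineCoord (l w) - q) / (p - q)‖)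
      (by fun_prop) fun η hη => ?_
    have hsmall := OnePoint.continuous_coe.continuousAt.tendsto.eventually <|
      eventually_norm_fracLinear_div_sub_one_lt (α := 1) (β := -p) hd hp hqK
        (fun h => hpq (by linear_combination -h))
        (fun z hz => by
          induction z using OnePoint.rec with
          | infty => exact one_ne_zero
          | coe z =>
            have h1 : z - q ≠ 0 := sub_ne_zero.2 fun h => hz (h ▸ hqK)
            have h2 : z - p ≠ 0 := sub_ne_zero.2 fun h => hz (h ▸ hp)
            rw [fracLinear_coe, one_mul, ← sub_eq_add_neg]
            exact div_ne_zero h2 h1) hη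
    filter_upwards [hsmall, hlcont.eventually_ne (by rw [hl0]; exact OnePoint.coe_ne_infty p)]
      with w hw hlw
    by_cases hwK : (w : OnePoint ℂ) ∈ K
    · rw [hl _ hwK, show affineCoord (w : OnePoint ℂ) = w from rfl, sub_self, norm_zero]
      positivity
    have hlwK : l w ∉ K := fun h => hwK (l.injective (hl _ h) ▸ h)
    replace hw := hw hwK
    have hwp : w - p ≠ 0 := sub_ne_zero.2 fun h => hwK (h ▸ hp)
    have hwq : w - q ≠ 0 := sub_ne_zero.2 fun h => hwK (h ▸ hqK)
    rw [abs_norm]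
    generalize l w = v at hw hlw hlwK
    induction v using OnePoint.rec with
    | infty => exact absurd rfl hlw
    | coe v =>
      have hvq : v - q ≠ 0 := sub_ne_zero.2 fun h => hlwK (h ▸ hqK)
      have key : affineCoord (v : OnePoint ℂ) - w =
          (fracLinear 1 (-p) q v / fracLinear 1 (-p) q w - 1) *
            ((affineCoord (v : OnePoint ℂ) - q) / (p - q)) * (w - p) := by
        simp only [affineCoord, fracLinear_coe, one_mul, ← sub_eq_add_neg]
        field_simp
        ring
      rw [key, norm_mul, norm_mul]
      gcongr
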